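/- Let $\Sigma$ be a smooth surface (without boundary) immersed in $\mathbb{R}^3$, with local unit normal $N$. Write $\psi(p)=\langle p,N(p)\rangle$ for the support function, $\Lambda(p)=\langle p,p\rangle$, $H=-\tfrac12\operatorname{tr}(dN)$ for the mean curvature and $K=\det(dN)$ for the Gaussian curvature. Call $\Sigma$ an SS-surface (surface of spherical type via the support function) if for every $p\in\Sigma$ with $K(p)\neq 0$ the sphere with centre $p+\bigl(\tfrac{H(p)}{K(p)}+\tfrac{\psi(p)}{2}\bigr)N(p)$ and radius $\bigl|\tfrac{H(p)}{K(p)}+\tfrac{\psi(p)}{2}\bigr|$ passes through the origin, and the relation $$2\psi H+(\Lambda+\psi^2)K=0$$ holds at every $p\in\Sigma$ (where $K\ne 0$ the two conditions are equivalent; both are unchanged when $N$ is replaced by $-N$). Theorem. Every compact, connected SS-surface is a round sphere centred at the origin: the immersion is one-to-one and its image is $\{x\in\mathbb{R}^3:|x|=r\}$ for some $r>0$. -/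

import Mathlib

open scoped Manifold ContDiff RealInnerProductSpace

namespace SSSurf

noncomputable section

/-- The parameter plane `ℝ²` with its Euclidean structure. -/
abbrev Plane := EuclideanSpace ℝ (Fin 2)

/-- Euclidean three-space `ℝ³`. -/
abbrev Space := EuclideanSpace ℝ (Fin 3)

/-! ### Curvatures and support function of a parametrized surface patch

Here `X` is a map from (an open part of) the plane to `ℝ³`, smooth and immersive near `u`. -/

/-- The partial derivative `X_{,i}`. -/
def partialD (X : Plane → Space) (i : Fin 2) (u : Plane) : Space :=
  fderiv ℝ X u (EuclideanSpace.single i 1)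

/-- The second partial derivative `X_{,ij}`. -/
def partialD₂ (X : Plane → Space) (i j : Fin 2) (u : Plane) : Space :=
  partialD (partialD X i) j u

/-- The vector product on `ℝ³`. -/
def cross (a b : Space) : Space :=
  WithLp.toLp 2 (crossProduct (WithLp.ofLp a) (WithLp.ofLp b))

/-- The unit normal `N = (X_{,1} × X_{,2}) / |X_{,1} × X_{,2}|`. -/
def unitNormal (X : Plane → Space) (u : Plane) : Space :=
  ‖cross (partialD X 0 u) (partialD X 1 u)‖⁻¹ • cross (partialD X 0 u) (partialD X 1 u)

/-- The coefficients `⟨X_{,i}, X_{,j}⟩` of the first fundamental form, as a matrix. -/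
def firstForm (X : Plane → Space) (u : Plane) : Matrix (Fin 2) (Fin 2) ℝ :=
  Matrix.of fun i j => ⟪partialD X i u, partialD X j u⟫

/-- The coefficients `b_{ij} = ⟨X_{,ij}, N⟩` (the normal components of `X_{,ij}`), as a matrix. -/
def secondForm (X : Plane → Space) (u : Plane) : Matrix (Fin 2) (Fin 2) ℝ :=
  Matrix.of fun i j => ⟪partialD₂ X i j u, unitNormal X u⟫

/-- The matrix `g⁻¹ b` of `-dN` (the shape operator) in the basis `X_{,1}, X_{,2}`. -/
def shapeMatrix (X : Plane → Space) (u : Plane) : Matrix (Fin 2) (Fin 2) ℝ :=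
  (firstForm X u)⁻¹ * secondForm X u

/-- The mean curvature `H`; with this sign a sphere of radius `r` with its outer normal has
`H = -1/r`. -/
def meanCurv (X : Plane → Space) (u : Plane) : ℝ := (shapeMatrix X u).trace / 2

/-- The Gaussian curvature `K`. -/
def gaussCurv (X : Plane → Space) (u : Plane) : ℝ := (shapeMatrix X u).det

/-- The support function `ψ = ⟨p, N(p)⟩`. -/
def support (X : Plane → Space) (u : Plane) : ℝ := ⟪X u, unitNormal X u⟫

/-- The quadratic distance function `Λ = ⟨p, p⟩`. -/
def distSq (X : Plane → Space) (u : Plane) : ℝ := ⟪X u, X u⟫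

/-- The signed radius `H / K + ψ / 2`. -/
def sphereRadius (X : Plane → Space) (u : Plane) : ℝ :=
  meanCurv X u / gaussCurv X u + support X u / 2

/-- The centre `p + (H / K + ψ / 2) N(p)`. -/
def sphereCenter (X : Plane → Space) (u : Plane) : Space :=
  X u + sphereRadius X u • unitNormal X u

/-- The spherical-type condition via the support function at one point of a patch.
Where `K ≠ 0`, the sphere with centre `p + (H / K + ψ / 2) N(p)` and radius `|H / K + ψ / 2|`
passes through the origin; and the relation `2 ψ H + (Λ + ψ²) K = 0` holds. Where `K ≠ 0` the two
clauses are equivalent; where `K = 0` the sphere is undefined and only the relation is required.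
Replacing `N` by `-N` changes the sign of `H` and of `ψ`, so the condition does not depend on the
choice of the normal. -/
structure IsSSAt (X : Plane → Space) (u : Plane) : Prop where
  sphere : gaussCurv X u ≠ 0 →
    (0 : Space) ∈ Metric.sphere (sphereCenter X u) |sphereRadius X u|
  relation : 2 * support X u * meanCurv X u
    + (distSq X u + support X u ^ 2) * gaussCurv X u = 0

/-- A smooth surface without boundary `M` immersed in `ℝ³` by `f` is an SS-surface if the
spherical-type condition holds at each of its points, in every chart of the atlas of `M`
(embedded surfaces are the case where `f` is an inclusion). -/
structure IsSSSurface {M : Type*} [TopologicalSpace M] [ChartedSpace Plane M]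
    (f : M → Space) : Prop where
  smooth : ContMDiff (𝓡 2) 𝓘(ℝ, Space) ∞ f
  immersion : ∀ p : M, Function.Injective (mfderiv (𝓡 2) 𝓘(ℝ, Space) f p)
  ss : ∀ φ ∈ atlas Plane M, ∀ u ∈ φ.target, IsSSAt (f ∘ φ.symm) u

end

end SSSurf

/-!
The proof is a maximum principle for `Λ = ⟨p, p⟩`, followed by a covering argument.

Let `X` be a patch with `n = X_{,1} × X_{,2}`, `s = ⟨X, n⟩` and `m_{ij} = ⟨X_{,ij}, n⟩`. Decomposing
`X_{,ij}` and `X` into tangential and normal parts, the second derivatives of `Λ` are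
`2 (m_{ij} s / D + g_{ij})`, where `D = det g`, up to terms linear in the first derivatives of `Λ`.
Contracting with `-s` times the cofactor matrix of `m` produces `-2 s (Kψ + H)` up to a positive
factor, and the SS-relation `2ψH + (Λ + ψ²)K = 0` turns this into a multiple of `Λ - ψ²`, the
squared length of the tangential part of `X`, which is quadratic in the gradient of `Λ`. Hence `Λ`
satisfies a linear second-order equation without zeroth-order term, whose principal part is the
cofactor matrix of `-s m` (`IsSSAt.elliptic_equation`).

At a maximum of `Λ` the form `-s m` is positive definite
(`second_form_definite_of_isLocalMax`), so the equation is elliptic nearby, and Hopf's strong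
maximum principle (`eventually_eq_of_isLocalMax_of_elliptic`) makes `Λ` constant near that point.
The set where `Λ` attains its maximum is therefore open and closed, and `Λ` is constant on the connected
surface: the image lies in a sphere about the origin.

An immersion into a sphere of the same dimension is a local homeomorphism. As the surface is
compact it is a covering of the sphere, and since the sphere is the union of two open
copies of the plane with connected intersection, a connected covering of it is one-to-one
(`injective_of_isCoveringMap_sphere`).
-/

namespace SSSurf

open Filter Topology

/-! ### The strong maximum principle -/

section MaximumPrinciple

variable {E : Type*} [NormedAddCommGroup E]

/-- The second-order necessary condition at a local maximum, for a second derivative given as the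
derivative of the derivative. -/
theorem second_fderiv_nonpos_of_isLocalMax [NormedSpace ℝ E] {w : E → ℝ} {w' : E → E →L[ℝ] ℝ}
    {w'' : E →L[ℝ] E →L[ℝ] ℝ} {x : E} (hmax : IsLocalMax w x)
    (hw : ∀ᶠ y in 𝓝 x, HasFDerivAt w (w' y) y) (hw' : HasFDerivAt w' w'' x) (η : E) :
    w'' η η ≤ 0 := by
  by_contra! hpos
  set l : ℝ → E := fun t => x + t • η with hl
  have hl0 : l 0 = x := by simp [hl]
  have hld : ∀ t, HasDerivAt l η t := fun t => by
    have := ((hasDerivAt_id t).smul_const η).const_add x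
    rwa [one_smul] at this
  have hlc : Tendsto l (𝓝 0) (𝓝 x) := by
    have := (hld 0).continuousAt.tendsto
    rwa [hl0] at this
  have hg : ∀ᶠ t in 𝓝 (0 : ℝ), HasDerivAt (w ∘ l) (w' (l t) η) t :=
    (hlc.eventually hw).mono fun t ht => ht.comp_hasDerivAt t (hld t)
  have hg1 : deriv (w ∘ l) =ᶠ[𝓝 0] fun t => w' (l t) η := hg.mono fun t ht => ht.deriv
  have hg2 : deriv (deriv (w ∘ l)) 0 = w'' η η := by
    rw [hg1.deriv_eq]
    have h1 : HasDerivAt (w' ∘ l) (w'' η) 0 :=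
      HasFDerivAt.comp_hasDerivAt (0 : ℝ) (by rwa [hl0]) (hld 0)
    exact (h1.clm_apply (hasDerivAt_const (0 : ℝ) η)).deriv.trans (by simp)
  have hmax' : IsLocalMax (w ∘ l) 0 := by
    have := hlc.eventually hmax
    filter_upwards [this] with t ht
    simpa [hl0] using ht
  have hmin : IsLocalMin (w ∘ l) 0 :=
    isLocalMin_of_deriv_deriv_pos (by rw [hg2]; exact hpos) hmax'.deriv_eq_zero
      hg.self_of_nhds.continuousAt
  -- A point that is both a local minimum and a local maximum has a flat neighbourhood.
  have hconst : w ∘ l =ᶠ[𝓝 0] fun _ => (w ∘ l) 0 := by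
    filter_upwards [hmax', hmin] with t h1 h2 using le_antisymm h1 h2
  have h0 : deriv (deriv (w ∘ l)) 0 = 0 := by
    rw [hconst.deriv.deriv_eq]; simp
  rw [hg2] at h0
  exact hpos.ne' h0

variable [InnerProductSpace ℝ E]

/-- The real inner product as a continuous bilinear form (`innerSL` is semilinear in its first
argument, which does not fit second derivatives). -/
noncomputable def innerBilin (E : Type*) [NormedAddCommGroup E] [InnerProductSpace ℝ E] :
    E →L[ℝ] E →L[ℝ] ℝ :=
  (innerₗ E).mkContinuous₂ 1 fun x y => by
    simpa using norm_inner_le_norm (𝕜 := ℝ) x y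

@[simp] theorem innerBilin_apply (x y : E) : innerBilin E x y = ⟪x, y⟫ := rfl

theorem hasFDerivAt_exp_neg_mul_norm_sq (α : ℝ) (c x : E) :
    HasFDerivAt (fun y => Real.exp (-α * ‖y - c‖ ^ 2))
      ((-2 * α * Real.exp (-α * ‖x - c‖ ^ 2)) • innerBilin E (x - c)) x := by
  have h1 : HasFDerivAt (fun y : E => ‖y - c‖ ^ 2) ((2 : ℝ) • innerSL ℝ (x - c)) x := by
    have := ((hasFDerivAt_id x).sub_const c).norm_sq
    refine this.congr_fderiv ?_
    ext; simp
  refine ((h1.const_mul (-α)).exp).congr_fderiv ?_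
  ext; simp; ring

theorem hasFDerivAt_fderiv_exp_neg_mul_norm_sq (α : ℝ) (c x : E) :
    HasFDerivAt
      (fun y => (-2 * α * Real.exp (-α * ‖y - c‖ ^ 2)) • innerBilin E (y - c))
      ((-2 * α * Real.exp (-α * ‖x - c‖ ^ 2)) • innerBilin E +
        ((-2 * α) • ((-2 * α * Real.exp (-α * ‖x - c‖ ^ 2)) •
          innerBilin E (x - c))).smulRight (innerBilin E (x - c))) x := by
  have h1 := (hasFDerivAt_exp_neg_mul_norm_sq α c x).const_mul (-2 * α)
  have h2 : HasFDerivAt (fun y : E => innerBilin E (y - c))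
      (innerBilin E) x := by
    have := ((innerBilin E).hasFDerivAt (x := x - c)).comp x
      ((hasFDerivAt_id x).sub_const c)
    exact this
  exact h1.smul h2

variable {ι : Type*} [Fintype ι]

/-- The barrier inequality in Hopf's argument: for this `α`, the operator
`∑ D²(ξ k, ξ k) + D(β)` applied to `exp (-α ‖η‖²)` is positive on the annulus
`s / 2 ≤ ‖η‖ ≤ 3 s / 2` (the exponential factor has been divided out). -/
theorem hopf_barrier_pos {ξ : ι → E} {β η : E} {lam B s α : ℝ} (hlam : 0 < lam) (hs : 0 < s)
    (hB : 0 ≤ B) (hα : α = (2 * B + 3 * B * s + 1) / (lam * s ^ 2))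
    (hell : lam * ‖η‖ ^ 2 ≤ ∑ k, ⟪ξ k, η⟫ ^ 2) (hξ : ∑ k, ‖ξ k‖ ^ 2 ≤ B) (hβ : ‖β‖ ≤ B)
    (h1 : s / 2 ≤ ‖η‖) (h2 : ‖η‖ ≤ 3 * s / 2) :
    0 < 4 * α ^ 2 * ∑ k, ⟪ξ k, η⟫ ^ 2 - 2 * α * ∑ k, ‖ξ k‖ ^ 2 - 2 * α * ⟪η, β⟫ := by
  have hα0 : 0 < α := by rw [hα]; positivity
  have hαs : α * (lam * s ^ 2) = 2 * B + 3 * B * s + 1 := by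
    rw [hα]; field_simp
  have h3 : lam * (s / 2) ^ 2 ≤ ∑ k, ⟪ξ k, η⟫ ^ 2 := le_trans (by gcongr) hell
  have h4 : ⟪η, β⟫ ≤ 3 * s / 2 * B :=
    (real_inner_le_norm η β).trans (by gcongr)
  have h5 : α * (lam * (s / 2) ^ 2) ≤ α * ∑ k, ⟪ξ k, η⟫ ^ 2 := by gcongr
  have h6 : 0 < 4 * (α * ∑ k, ⟪ξ k, η⟫ ^ 2) - 2 * ∑ k, ‖ξ k‖ ^ 2 - 2 * ⟪η, β⟫ := by
    nlinarith
  have := mul_pos hα0 h6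
  linarith [this]

set_option maxHeartbeats 1000000 in
/-- Hopf's strong maximum principle near a point, for an operator whose second-order part is the
sum of squares `∑ D²w(ξ k, ξ k)`; uniform ellipticity is the first hypothesis on `ξ`. If `w` were
not constant near `x₀`, some ball would touch the set where `w` is maximal at a single point `z` of
its boundary. Near `z` a small multiple of the barrier `exp (-α ‖x - c‖²) - exp (-α s²)` is added to
`w`: the sum has an interior maximum, where the operator is at most `0` by the second derivative
test but positive by the choice of `α`. -/
theorem eventually_eq_of_isLocalMax_of_elliptic [FiniteDimensional ℝ E] {w : E → ℝ} {x₀ : E}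
    (hw : ContDiffAt ℝ 2 w x₀) {ξ : ι → E → E} {β : E → E} {lam B : ℝ} (hlam : 0 < lam)
    (hell : ∀ᶠ x in 𝓝 x₀, ∀ η, lam * ‖η‖ ^ 2 ≤ ∑ k, ⟪ξ k x, η⟫ ^ 2)
    (hξ : ∀ᶠ x in 𝓝 x₀, ∑ k, ‖ξ k x‖ ^ 2 ≤ B) (hβ : ∀ᶠ x in 𝓝 x₀, ‖β x‖ ≤ B)
    (hL : ∀ᶠ x in 𝓝 x₀,
      0 ≤ ∑ k, fderiv ℝ (fderiv ℝ w) x (ξ k x) (ξ k x) + fderiv ℝ w x (β x))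
    (hmax : IsLocalMax w x₀) : ∀ᶠ x in 𝓝 x₀, w x = w x₀ := by
  have hB : 0 ≤ B := (norm_nonneg _).trans hβ.self_of_nhds
  have hev := (hw.eventually (by simp)).and (hell.and (hξ.and (hβ.and (hL.and hmax))))
  obtain ⟨ρ, hρ, hball⟩ := Metric.eventually_nhds_iff_ball.1 hev
  set r := ρ / 4 with hr
  have hr0 : 0 < r := by positivity
  have hmx : ∀ x ∈ Metric.ball x₀ ρ, w x ≤ w x₀ := fun x hx => (hball x hx).2.2.2.2.2
  have hwc : ∀ x ∈ Metric.ball x₀ ρ, ContinuousAt w x := fun x hx => (hball x hx).1.continuousAt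
  set M := w x₀ with hM
  filter_upwards [Metric.ball_mem_nhds x₀ hr0] with y hy
  by_contra hne
  rw [Metric.mem_ball] at hy
  have hyM : w y < M := lt_of_le_of_ne (hmx y (by rw [Metric.mem_ball]; linarith)) hne
  have hsub : Metric.closedBall x₀ (2 * r) ⊆ Metric.ball x₀ ρ :=
    Metric.closedBall_subset_ball (by linarith)
  have hcont : ContinuousOn w (Metric.closedBall x₀ (2 * r)) := fun x hx =>
    (hwc x (hsub hx)).continuousWithinAt
  -- `z` is the point of the contact set `w = M` that is nearest to `y`.
  set F := Metric.closedBall x₀ (2 * r) ∩ w ⁻¹' {M} with hF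
  have hFc : IsCompact F := (isCompact_closedBall x₀ (2 * r)).of_isClosed_subset
    (hcont.preimage_isClosed_of_isClosed Metric.isClosed_closedBall isClosed_singleton)
    Set.inter_subset_left
  have hx₀F : x₀ ∈ F := ⟨Metric.mem_closedBall_self (by linarith), rfl⟩
  obtain ⟨z, hzF, hzmin⟩ := hFc.exists_isMinOn ⟨x₀, hx₀F⟩
    (continuous_const.dist continuous_id : Continuous fun x => dist y x).continuousOn
  have hzmin' : ∀ x ∈ F, dist y z ≤ dist y x := fun x hx => hzmin hx
  set R := dist y z with hR
  have hRr : R < r := (hzmin' x₀ hx₀F).trans_lt hy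
  have hzM : w z = M := hzF.2
  have hR0 : 0 < R := dist_pos.2 fun h => hyM.ne (h ▸ hzM)
  have hzx : dist z x₀ < 2 * r := by
    have := dist_triangle z y x₀
    rw [dist_comm z y] at this
    linarith
  set c := (2⁻¹ : ℝ) • (y + z) with hc
  set s := R / 2 with hs
  have hs0 : 0 < s := by positivity
  have hzc : ‖z - c‖ = s := by
    have : z - c = (2⁻¹ : ℝ) • (z - y) := by rw [hc]; module
    rw [this, norm_smul, ← dist_eq_norm, dist_comm z y]
    norm_num
    rw [← hR, hs]; ring
  -- The ball about the midpoint `c` of `y` and `z` touches the contact set at `z` alone.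
  have htouch : ∀ x, ‖x - c‖ ≤ s → x ≠ z → w x < M := by
    intro x hx hxz
    have hcy : ‖c - y‖ = s := by
      have : c - y = (2⁻¹ : ℝ) • (z - y) := by rw [hc]; module
      rw [this, norm_smul, ← dist_eq_norm, dist_comm z y]
      norm_num
      rw [← hR, hs]; ring
    have hxy : dist y x ≤ R := by
      have := norm_sub_le_norm_sub_add_norm_sub x c y
      rw [dist_comm, dist_eq_norm]
      linarith
    have hxb : x ∈ Metric.closedBall x₀ (2 * r) := by
      have := dist_triangle x y x₀
      rw [dist_comm x y] at this
      rw [Metric.mem_closedBall]; linarith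
    refine lt_of_le_of_ne (hmx x (hsub hxb)) fun hxM => hxz ?_
    have hge := hzmin' x ⟨hxb, hxM⟩
    have hpar := parallelogram_law_with_norm ℝ (x - y) (x - z)
    have e1 : x - y + (x - z) = (2 : ℝ) • (x - c) := by rw [hc]; module
    have e2 : x - y - (x - z) = z - y := by abel
    rw [e1, e2, norm_smul, ← dist_eq_norm z y, dist_comm z y, ← hR, ← dist_eq_norm x y,
      dist_comm x y] at hpar
    have h2 : ‖(2 : ℝ)‖ = 2 := by norm_num
    rw [h2] at hpar
    have hz0 : ‖x - z‖ = 0 := by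
      have := norm_nonneg (x - z)
      have := norm_nonneg (x - c)
      have : ‖x - c‖ * ‖x - c‖ ≤ s * s := by gcongr
      have : R * R ≤ dist y x * dist y x := by gcongr
      have : ‖x - z‖ * ‖x - z‖ ≤ 0 := by nlinarith
      nlinarith
    exact sub_eq_zero.1 (norm_eq_zero.1 hz0)
  set α := (2 * B + 3 * B * s + 1) / (lam * s ^ 2) with hα
  have hα0 : 0 < α := by rw [hα]; positivity
  set v : E → ℝ := fun x => Real.exp (-α * ‖x - c‖ ^ 2) - Real.exp (-α * s ^ 2) with hv
  have hvc : Continuous v := by fun_prop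
  set δ := s / 2 with hδ
  have hδ0 : 0 < δ := by positivity
  have hδb : Metric.closedBall z δ ⊆ Metric.ball x₀ ρ := by
    intro x hx
    have := dist_triangle x z x₀
    rw [Metric.mem_closedBall] at hx
    rw [Metric.mem_ball]; linarith
  have hKm : ∃ m < M, ∀ x ∈ Metric.sphere z δ ∩ Metric.closedBall c s, w x ≤ m := by
    have hKc : IsCompact (Metric.sphere z δ ∩ Metric.closedBall c s) :=
      (isCompact_sphere z δ).inter_right Metric.isClosed_closedBall
    rcases (Metric.sphere z δ ∩ Metric.closedBall c s).eq_empty_or_nonempty with h | h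
    · exact ⟨M - 1, by linarith, by simp [h]⟩
    · obtain ⟨x, hx, hxm⟩ := hKc.exists_isMaxOn h (f := w) fun x hx =>
        (hwc x (hδb (Metric.sphere_subset_closedBall hx.1))).continuousWithinAt
      refine ⟨w x, htouch x ?_ ?_, fun y hy => hxm hy⟩
      · rw [← dist_eq_norm]; exact hx.2
      · exact Metric.ne_of_mem_sphere hx.1 hδ0.ne'
  obtain ⟨m, hmM, hm⟩ := hKm
  set ε := (M - m) / 2 with hε
  have hε0 : 0 < ε := by rw [hε]; linarith
  -- On the sphere about `z`: inside the touching ball `w` stays away from `M`, outside it `v < 0`.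
  have hbd : ∀ x ∈ Metric.sphere z δ, w x + ε * v x < M := by
    intro x hx
    by_cases hxc : x ∈ Metric.closedBall c s
    · have h1 := hm x ⟨hx, hxc⟩
      have h2 : v x ≤ 1 := by
        have h3 : Real.exp (-α * ‖x - c‖ ^ 2) ≤ 1 :=
          Real.exp_le_one_iff.2 (by nlinarith [sq_nonneg ‖x - c‖])
        have := Real.exp_pos (-α * s ^ 2)
        simp only [hv]; linarith
      nlinarith
    · have h1 := hmx x (hδb (Metric.sphere_subset_closedBall hx))
      rw [Metric.mem_closedBall, dist_eq_norm, not_le] at hxc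
      have h2 : v x < 0 := by
        have : s ^ 2 < ‖x - c‖ ^ 2 := by gcongr
        simp only [hv]
        refine sub_neg.2 (Real.exp_lt_exp.2 ?_)
        nlinarith
      nlinarith
  obtain ⟨x, hx, hxmax⟩ := (isCompact_closedBall z δ).exists_isMaxOn
    ⟨z, Metric.mem_closedBall_self hδ0.le⟩ (f := fun x => w x + ε * v x) fun x hx =>
      ((hwc x (hδb hx)).add (continuousAt_const.mul hvc.continuousAt)).continuousWithinAt
  have hxM : M ≤ w x + ε * v x := by
    have h1 : w z + ε * v z ≤ w x + ε * v x := hxmax (Metric.mem_closedBall_self hδ0.le)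
    have h2 : v z = 0 := by simp [hv, hzc]
    rw [h2, hzM] at h1
    linarith
  have hxb : x ∈ Metric.ball z δ := by
    rw [Metric.mem_ball]
    refine lt_of_le_of_ne hx fun h => ?_
    exact (hbd x h).not_ge hxM
  have hloc : IsLocalMax (fun x => w x + ε * v x) x :=
    hxmax.isLocalMax (Filter.mem_of_superset (Metric.isOpen_ball.mem_nhds hxb)
      Metric.ball_subset_closedBall)
  obtain ⟨hx1, hx2, hx3, hx4, hx5, -⟩ := hball x (hδb hx)
  set g : E → E →L[ℝ] ℝ := fun y => (-2 * α * Real.exp (-α * ‖y - c‖ ^ 2)) • innerBilin E (y - c)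
    with hg
  have hvd : ∀ y, HasFDerivAt v (g y) y := fun y =>
    (hasFDerivAt_exp_neg_mul_norm_sq α c y).sub_const _
  have hWd : ∀ᶠ y in 𝓝 x, HasFDerivAt (fun x => w x + ε * v x) (fderiv ℝ w y + ε • g y) y :=
    (hx1.eventually (by simp)).mono fun y hy =>
      (hy.differentiableAt (by norm_num)).hasFDerivAt.add ((hvd y).const_mul ε)
  have hw2 : HasFDerivAt (fderiv ℝ w) (fderiv ℝ (fderiv ℝ w) x) x :=
    ((hx1.fderiv_right (m := 1) (by norm_num)).differentiableAt (by norm_num)).hasFDerivAt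
  have hWd2 := hw2.add ((hasFDerivAt_fderiv_exp_neg_mul_norm_sq α c x).const_smul ε)
  have hgrad : fderiv ℝ w x (β x) + ε * g x (β x) = 0 := by
    have := hloc.hasFDerivAt_eq_zero hWd.self_of_nhds
    simpa using DFunLike.congr_fun this (β x)
  have hhess := fun k => second_fderiv_nonpos_of_isLocalMax hloc hWd hWd2 (ξ k x)
  have hη1 : s / 2 ≤ ‖x - c‖ := by
    have h1 := norm_sub_le_norm_sub_add_norm_sub z x c
    rw [Metric.mem_closedBall, dist_comm, dist_eq_norm] at hx
    linarith
  have hη2 : ‖x - c‖ ≤ 3 * s / 2 := by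
    have h1 := norm_sub_le_norm_sub_add_norm_sub x z c
    rw [Metric.mem_closedBall, dist_eq_norm] at hx
    linarith
  have hbar := hopf_barrier_pos hlam hs0 hB hα (hx2 (x - c)) hx3 hx4 hη1 hη2
  set e := Real.exp (-α * ‖x - c‖ ^ 2) with he
  have he0 : 0 < e := Real.exp_pos _
  have hhess' : ∀ k, fderiv ℝ (fderiv ℝ w) x (ξ k x) (ξ k x) +
      ε * (e * (4 * α ^ 2 * ⟪ξ k x, x - c⟫ ^ 2 - 2 * α * ‖ξ k x‖ ^ 2)) ≤ 0 := by
    intro k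
    refine le_of_eq_of_le ?_ (hhess k)
    show _ = fderiv ℝ (fderiv ℝ w) x (ξ k x) (ξ k x) + ε * (-2 * α * e * ⟪ξ k x, ξ k x⟫ +
      -2 * α * (-2 * α * e * ⟪x - c, ξ k x⟫) * ⟪x - c, ξ k x⟫)
    rw [real_inner_self_eq_norm_sq, real_inner_comm (ξ k x) (x - c)]
    ring
  have hsum := Finset.sum_nonpos fun k (_ : k ∈ Finset.univ) => hhess' k
  rw [Finset.sum_add_distrib, ← Finset.mul_sum, ← Finset.mul_sum, Finset.sum_sub_distrib,
    ← Finset.mul_sum, ← Finset.mul_sum] at hsum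
  have hgx : g x (β x) = e * (-2 * α * ⟪x - c, β x⟫) := by
    show -2 * α * e * ⟪x - c, β x⟫ = _
    ring
  rw [hgx] at hgrad
  have := mul_pos hε0 (mul_pos he0 hbar)
  nlinarith

end MaximumPrinciple

/-! ### Vector algebra and the SS-relation as a polynomial identity -/

section Vectors

theorem inner_eq_coords (a b : Space) : ⟪a, b⟫ = a 0 * b 0 + a 1 * b 1 + a 2 * b 2 := by
  simp [PiLp.inner_apply, Fin.sum_univ_three]; ring

theorem cross_zero (a b : Space) : cross a b 0 = a 1 * b 2 - a 2 * b 1 := by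
  simp [cross, cross_apply]

theorem cross_one (a b : Space) : cross a b 1 = a 2 * b 0 - a 0 * b 2 := by
  simp [cross, cross_apply]

theorem cross_two (a b : Space) : cross a b 2 = a 0 * b 1 - a 1 * b 0 := by
  simp [cross, cross_apply]

theorem inner_cross_self (a b : Space) :
    ⟪cross a b, cross a b⟫ = ⟪a, a⟫ * ⟪b, b⟫ - ⟪a, b⟫ ^ 2 := by
  simp only [inner_eq_coords, cross_zero, cross_one, cross_two]; ring

/-- Decomposition of an inner product along the frame `a, b, a × b`, with denominators cleared. -/
theorem gram_mul_inner (a b x t : Space) :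
    (⟪a, a⟫ * ⟪b, b⟫ - ⟪a, b⟫ ^ 2) * ⟪t, x⟫ =
      (⟪b, b⟫ * ⟪t, a⟫ - ⟪a, b⟫ * ⟪t, b⟫) * ⟪x, a⟫ +
        (⟪a, a⟫ * ⟪t, b⟫ - ⟪a, b⟫ * ⟪t, a⟫) * ⟪x, b⟫ + ⟪t, cross a b⟫ * ⟪x, cross a b⟫ := by
  simp only [inner_eq_coords, cross_zero, cross_one, cross_two]; ring

theorem continuous_cross : Continuous fun p : Space × Space => cross p.1 p.2 := by
  unfold cross
  simp only [cross_apply]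
  fun_prop

theorem gram_pos {T : Plane →L[ℝ] Space} (hT : Function.Injective T) :
    0 < ⟪T (EuclideanSpace.single 0 1), T (EuclideanSpace.single 0 1)⟫ *
        ⟪T (EuclideanSpace.single 1 1), T (EuclideanSpace.single 1 1)⟫ -
      ⟪T (EuclideanSpace.single 0 1), T (EuclideanSpace.single 1 1)⟫ ^ 2 := by
  set a := T (EuclideanSpace.single 0 1)
  set b := T (EuclideanSpace.single 1 1)
  have hne : ∀ x : Plane, x ≠ 0 → 0 < ⟪T x, T x⟫ := fun x hx =>
    real_inner_self_pos.2 fun h => hx (hT (by rw [h, map_zero]))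
  have ha : 0 < ⟪a, a⟫ := hne _ fun h => by simpa using congrArg (fun x : Plane => x 0) h
  have hc := hne (⟪a, b⟫ • EuclideanSpace.single 0 1 - ⟪a, a⟫ • EuclideanSpace.single 1 1)
    fun h => ha.ne' (by simpa using congrArg (fun x : Plane => x 1) h)
  rw [map_sub, map_smul, map_smul] at hc
  change 0 < ⟪⟪a, b⟫ • a - ⟪a, a⟫ • b, ⟪a, b⟫ • a - ⟪a, a⟫ • b⟫ at hc
  simp only [inner_sub_left, inner_sub_right, real_inner_smul_left, real_inner_smul_right,
    real_inner_comm a b] at hc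
  have : 0 < ⟪a, a⟫ * (⟪a, a⟫ * ⟪b, b⟫ - ⟪a, b⟫ ^ 2) := by
    refine hc.trans_eq ?_
    ring
  exact pos_of_mul_pos_right this ha.le

end Vectors

section Patch

variable {X : Plane → Space} {u : Plane}

/-- The normal `X_{,1} × X_{,2}`, not normalized. -/
noncomputable def rawNormal (X : Plane → Space) (u : Plane) : Space :=
  cross (partialD X 0 u) (partialD X 1 u)

/-- The determinant of the first fundamental form. -/
noncomputable def gramDet (X : Plane → Space) (u : Plane) : ℝ :=
  ⟪partialD X 0 u, partialD X 0 u⟫ * ⟪partialD X 1 u, partialD X 1 u⟫ -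
    ⟪partialD X 0 u, partialD X 1 u⟫ ^ 2

/-- The second fundamental form with respect to the normal that is not normalized. -/
noncomputable def rawSecond (X : Plane → Space) (i j : Fin 2) (u : Plane) : ℝ :=
  ⟪partialD₂ X i j u, rawNormal X u⟫

/-- The support function with respect to the normal that is not normalized. -/
noncomputable def rawSupport (X : Plane → Space) (u : Plane) : ℝ :=
  ⟪X u, rawNormal X u⟫

theorem norm_rawNormal_sq : ‖rawNormal X u‖ ^ 2 = gramDet X u := by
  rw [← real_inner_self_eq_norm_sq, rawNormal, inner_cross_self, gramDet]

theorem det_firstForm : (firstForm X u).det = gramDet X u := by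
  simp [Matrix.det_fin_two, firstForm, gramDet, real_inner_comm (partialD X 0 u)]
  ring

/-- The SS-relation with denominators cleared and the unit normal replaced by `X_{,1} × X_{,2}`. -/
theorem IsSSAt.polynomial_relation (h : IsSSAt X u) (hD : 0 < gramDet X u)
    (hsymm : rawSecond X 0 1 u = rawSecond X 1 0 u) :
    gramDet X u * rawSupport X u *
        (⟪partialD X 1 u, partialD X 1 u⟫ * rawSecond X 0 0 u -
          2 * ⟪partialD X 0 u, partialD X 1 u⟫ * rawSecond X 0 1 u +
          ⟪partialD X 0 u, partialD X 0 u⟫ * rawSecond X 1 1 u) +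
      (gramDet X u * distSq X u + rawSupport X u ^ 2) *
        (rawSecond X 0 0 u * rawSecond X 1 1 u - rawSecond X 0 1 u ^ 2) = 0 := by
  set ν := ‖rawNormal X u‖ with hν
  have hν2 : ν ^ 2 = gramDet X u := norm_rawNormal_sq
  have hν0 : ν ≠ 0 := by
    intro h0
    rw [h0] at hν2
    simp at hν2
    exact hD.ne hν2
  have hN : unitNormal X u = ν⁻¹ • rawNormal X u := rfl
  have hb : ∀ i j, secondForm X u i j = ν⁻¹ * rawSecond X i j u := fun i j => by
    simp only [secondForm, Matrix.of_apply, hN, real_inner_smul_right, rawSecond]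
  have hs : support X u = ν⁻¹ * rawSupport X u := by
    simp only [support, hN, real_inner_smul_right, rawSupport]
  have hK : gaussCurv X u = (gramDet X u)⁻¹ * (ν⁻¹ ^ 2 *
      (rawSecond X 0 0 u * rawSecond X 1 1 u - rawSecond X 0 1 u ^ 2)) := by
    rw [gaussCurv, shapeMatrix, Matrix.det_mul, Matrix.det_nonsing_inv, det_firstForm,
      Ring.inverse_eq_inv', Matrix.det_fin_two (secondForm X u)]
    simp only [hb, ← hsymm]
    ring
  have hH : meanCurv X u = (gramDet X u)⁻¹ * (ν⁻¹ *
      (⟪partialD X 1 u, partialD X 1 u⟫ * rawSecond X 0 0 u -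
          2 * ⟪partialD X 0 u, partialD X 1 u⟫ * rawSecond X 0 1 u +
          ⟪partialD X 0 u, partialD X 0 u⟫ * rawSecond X 1 1 u)) / 2 := by
    rw [meanCurv, shapeMatrix, Matrix.inv_def, det_firstForm, Ring.inverse_eq_inv',
      Matrix.adjugate_fin_two, Matrix.trace_fin_two]
    simp [Matrix.mul_apply, Fin.sum_univ_two, hb, ← hsymm, firstForm,
      real_inner_comm (partialD X 0 u)]
    ring
  have hrel := h.relation
  rw [hK, hH, hs] at hrel
  have hD0 := hD.ne'
  rw [← hν2] at hrel hD0 ⊢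
  field_simp at hrel
  linear_combination hrel

end Patch

/-! ### The elliptic equation for the squared distance -/

section Patch

variable {X : Plane → Space} {u : Plane}

theorem fderiv_distSq_apply (hX : DifferentiableAt ℝ X u) (η : Plane) :
    fderiv ℝ (distSq X) u η = 2 * ⟪X u, fderiv ℝ X u η⟫ := by
  have : distSq X = fun y => ⟪X y, X y⟫ := rfl
  rw [this, fderiv_inner_apply ℝ hX hX, real_inner_comm]
  ring

theorem contDiffAt_distSq (hX : ContDiffAt ℝ 2 X u) : ContDiffAt ℝ 2 (distSq X) u :=
  hX.inner ℝ hX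

theorem differentiableAt_fderiv_of_contDiffAt {F : Type*} [NormedAddCommGroup F]
    [NormedSpace ℝ F] {g : Plane → F} (hg : ContDiffAt ℝ 2 g u) :
    DifferentiableAt ℝ (fderiv ℝ g) u :=
  (hg.fderiv_right (m := 1) (by norm_num)).differentiableAt (by norm_num)

theorem fderiv_fderiv_distSq_apply (hX : ContDiffAt ℝ 2 X u) (ξ η : Plane) :
    fderiv ℝ (fderiv ℝ (distSq X)) u ξ η =
      2 * (⟪fderiv ℝ (fderiv ℝ X) u ξ η, X u⟫ + ⟪fderiv ℝ X u ξ, fderiv ℝ X u η⟫) := by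
  have hX2 := differentiableAt_fderiv_of_contDiffAt hX
  have hw2 := differentiableAt_fderiv_of_contDiffAt (contDiffAt_distSq hX)
  have h1 : (fun y => fderiv ℝ (distSq X) y η) =ᶠ[𝓝 u] fun y => 2 * ⟪X y, fderiv ℝ X y η⟫ :=
    (hX.eventually (by simp)).mono fun y hy =>
      fderiv_distSq_apply (hy.differentiableAt (by norm_num)) η
  have h2 : fderiv ℝ (fun y => fderiv ℝ (distSq X) y η) u ξ =
      fderiv ℝ (fderiv ℝ (distSq X)) u ξ η := by
    rw [fderiv_clm_apply hw2 (differentiableAt_const η)]; simp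
  have h3 : fderiv ℝ (fun y => fderiv ℝ X y η) u ξ = fderiv ℝ (fderiv ℝ X) u ξ η := by
    rw [fderiv_clm_apply hX2 (differentiableAt_const η)]; simp
  have hd : DifferentiableAt ℝ (fun y => fderiv ℝ X y η) u :=
    hX2.clm_apply (differentiableAt_const η)
  have hX1 : DifferentiableAt ℝ X u := hX.differentiableAt (by norm_num)
  rw [← h2, h1.fderiv_eq, fderiv_const_mul (hX1.inner ℝ hd)]
  rw [_root_.smul_apply, fderiv_inner_apply ℝ hX1 hd, h3, real_inner_comm (X u),
    smul_eq_mul]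

theorem partialD₂_eq (hX : ContDiffAt ℝ 2 X u) (i j : Fin 2) :
    partialD₂ X i j u = fderiv ℝ (fderiv ℝ X) u (EuclideanSpace.single j 1)
      (EuclideanSpace.single i 1) := by
  have : partialD X i = fun y => fderiv ℝ X y (EuclideanSpace.single i 1) := rfl
  rw [partialD₂, this, partialD, fderiv_clm_apply (differentiableAt_fderiv_of_contDiffAt hX)
    (differentiableAt_const _)]
  simp

theorem partialD₂_comm (hX : ContDiffAt ℝ 2 X u) (i j : Fin 2) :
    partialD₂ X i j u = partialD₂ X j i u := by
  rw [partialD₂_eq hX, partialD₂_eq hX]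
  exact (hX.isSymmSndFDerivAt (by simp)).eq _ _

theorem continuousAt_partialD (hX : ContDiffAt ℝ 2 X u) (i : Fin 2) :
    ContinuousAt (partialD X i) u :=
  (differentiableAt_fderiv_of_contDiffAt hX).continuousAt.clm_apply continuousAt_const

theorem continuousAt_partialD₂ (hX : ContDiffAt ℝ 2 X u) (i j : Fin 2) :
    ContinuousAt (partialD₂ X i j) u := by
  have h1 : ContDiffAt ℝ 1 (partialD X i) u :=
    (hX.fderiv_right (m := 1) (by norm_num)).clm_apply contDiffAt_const
  exact ((h1.fderiv_right (m := 0) (by norm_num)).continuousAt).clm_apply continuousAt_const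

theorem continuousAt_rawNormal (hX : ContDiffAt ℝ 2 X u) : ContinuousAt (rawNormal X) u :=
  continuous_cross.continuousAt.comp
    ((continuousAt_partialD hX 0).prodMk (continuousAt_partialD hX 1))

theorem continuousAt_rawSecond (hX : ContDiffAt ℝ 2 X u) (i j : Fin 2) :
    ContinuousAt (rawSecond X i j) u :=
  (continuousAt_partialD₂ hX i j).inner (continuousAt_rawNormal hX)

theorem continuousAt_rawSupport (hX : ContDiffAt ℝ 2 X u) : ContinuousAt (rawSupport X) u :=
  hX.continuousAt.inner (continuousAt_rawNormal hX)

theorem continuousAt_gramDet (hX : ContDiffAt ℝ 2 X u) : ContinuousAt (gramDet X) u := by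
  have h0 := continuousAt_partialD hX 0
  have h1 := continuousAt_partialD hX 1
  exact ((h0.inner h0).mul (h1.inner h1)).sub ((h0.inner h1).pow 2)

/-- The discriminant of the (unnormalized) second fundamental form. -/
noncomputable def rawDisc (X : Plane → Space) (u : Plane) : ℝ :=
  rawSecond X 0 0 u * rawSecond X 1 1 u - rawSecond X 0 1 u ^ 2

/-- At a local maximum of `Λ` the surface lies inside the sphere about the origin that it touches,
so `-s m` is positive definite, `s` being the support function and `m` the second fundamental form.
The two inequalities are that its lower right entry and its determinant are positive. -/
theorem second_form_definite_of_isLocalMax (hX : ContDiffAt ℝ 2 X u)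
    (himm : Function.Injective (fderiv ℝ X u)) (hmax : IsLocalMax (distSq X) u) :
    0 < -(rawSupport X u * rawSecond X 1 1 u) ∧
      0 < rawSupport X u ^ 2 * rawDisc X u := by
  have hX1 : DifferentiableAt ℝ X u := hX.differentiableAt (by norm_num)
  have hD : 0 < gramDet X u := gram_pos himm
  have hw := contDiffAt_distSq hX
  have hgrad : ∀ η, ⟪X u, fderiv ℝ X u η⟫ = 0 := fun η => by
    have h := fderiv_distSq_apply hX1 η
    rw [hmax.fderiv_eq_zero] at h
    simpa using h.symm
  have hnorm : ∀ t : Space, gramDet X u * ⟪t, X u⟫ = ⟪t, rawNormal X u⟫ * rawSupport X u := by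
    intro t
    have := gram_mul_inner (partialD X 0 u) (partialD X 1 u) (X u) t
    have h0 : ⟪X u, partialD X 0 u⟫ = 0 := hgrad _
    have h1 : ⟪X u, partialD X 1 u⟫ = 0 := hgrad _
    rw [h0, h1] at this
    simpa [gramDet, rawNormal, rawSupport] using this
  have hpos : ∀ x y : ℝ, (x ≠ 0 ∨ y ≠ 0) →
      0 < -(rawSupport X u * (rawSecond X 0 0 u * x ^ 2 + 2 * rawSecond X 0 1 u * (x * y) +
        rawSecond X 1 1 u * y ^ 2)) := by
    intro x y hxy
    set ξ : Plane := x • EuclideanSpace.single 0 1 + y • EuclideanSpace.single 1 1 with hξ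
    have hξ0 : ξ ≠ 0 := by
      intro h
      have h0 := congrArg (fun z : Plane => z 0) h
      have h1 := congrArg (fun z : Plane => z 1) h
      simp [hξ] at h0 h1
      simp [h0, h1] at hxy
    have hdX : 0 < ⟪fderiv ℝ X u ξ, fderiv ℝ X u ξ⟫ :=
      real_inner_self_pos.2 fun h => hξ0 (himm (by rw [h, map_zero]))
    have hh := second_fderiv_nonpos_of_isLocalMax hmax
      ((hw.eventually (by simp)).mono fun y hy => (hy.differentiableAt (by norm_num)).hasFDerivAt)
      (differentiableAt_fderiv_of_contDiffAt hw).hasFDerivAt ξ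
    rw [fderiv_fderiv_distSq_apply hX] at hh
    have hneg : ⟪fderiv ℝ (fderiv ℝ X) u ξ ξ, X u⟫ < 0 := by linarith
    have h2 := mul_neg_of_pos_of_neg hD hneg
    rw [hnorm] at h2
    have h3 : fderiv ℝ (fderiv ℝ X) u ξ ξ = x ^ 2 • partialD₂ X 0 0 u +
        (2 * (x * y)) • partialD₂ X 0 1 u + y ^ 2 • partialD₂ X 1 1 u := by
      have hc := partialD₂_comm hX 1 0
      have e := partialD₂_eq hX
      simp only [hξ, map_add, map_smul, _root_.add_apply,
        _root_.smul_apply, ← e, hc]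
      module
    rw [h3, inner_add_left, inner_add_left, real_inner_smul_left, real_inner_smul_left,
      real_inner_smul_left] at h2
    change (x ^ 2 * rawSecond X 0 0 u + 2 * (x * y) * rawSecond X 0 1 u +
      y ^ 2 * rawSecond X 1 1 u) * rawSupport X u < 0 at h2
    linarith
  have h1 : 0 < -(rawSupport X u * rawSecond X 1 1 u) := by simpa using hpos 0 1 (by simp)
  have hm : rawSecond X 1 1 u ≠ 0 := by
    intro h; simp [h] at h1
  -- On this vector the form takes the value `m₁₁ det m`.
  have h2 := hpos (rawSecond X 1 1 u) (-rawSecond X 0 1 u) (Or.inl hm)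
  have h3 : 0 < -(rawSupport X u * rawSecond X 1 1 u) * rawDisc X u := by
    refine h2.trans_eq ?_
    rw [rawDisc]; ring
  have h4 : 0 < rawDisc X u := pos_of_mul_pos_right h3 h1.le
  have h5 : rawSupport X u ≠ 0 := by
    intro h; simp [h] at h1
  exact ⟨h1, by positivity⟩

/-- The coefficient of `X_{,i}` in the tangential part of `t`, times `gramDet`. The index `1 - i` is
the other element of `Fin 2`. -/
noncomputable def tangentialCoord (X : Plane → Space) (i : Fin 2) (t : Space) (u : Plane) : ℝ :=
  ⟪partialD X (1 - i) u, partialD X (1 - i) u⟫ * ⟪t, partialD X i u⟫ -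
    ⟪partialD X 0 u, partialD X 1 u⟫ * ⟪t, partialD X (1 - i) u⟫

/-- The coefficients of the first-order part of the elliptic equation satisfied by `Λ`. -/
noncomputable def driftCoord (X : Plane → Space) (i : Fin 2) (u : Plane) : ℝ :=
  rawSupport X u * (-rawSecond X 1 1 u * tangentialCoord X i (partialD₂ X 0 0 u) u +
    2 * rawSecond X 0 1 u * tangentialCoord X i (partialD₂ X 0 1 u) u -
    rawSecond X 0 0 u * tangentialCoord X i (partialD₂ X 1 1 u) u) +
  rawDisc X u * tangentialCoord X i (X u) u

theorem gramDet_mul_inner (t : Space) : gramDet X u * ⟪t, X u⟫ =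
    tangentialCoord X 0 t u * ⟪X u, partialD X 0 u⟫ +
      tangentialCoord X 1 t u * ⟪X u, partialD X 1 u⟫ + ⟪t, rawNormal X u⟫ * rawSupport X u := by
  simpa [gramDet, tangentialCoord, rawNormal, rawSupport] using
    gram_mul_inner (partialD X 0 u) (partialD X 1 u) (X u) t

/-- The equation satisfied by `Λ` on an SS-surface. Half the second derivatives of `Λ` are
`⟨X_{,ij}, X⟩ + ⟨X_{,i}, X_{,j}⟩` and half its first derivatives are `⟨X, X_{,i}⟩`; the
coefficients on the left are the cofactors of the second fundamental form. -/
theorem IsSSAt.elliptic_equation (h : IsSSAt X u) (hX : ContDiffAt ℝ 2 X u)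
    (hD : 0 < gramDet X u) :
    gramDet X u * rawSupport X u *
      (-rawSecond X 1 1 u * (⟪partialD₂ X 0 0 u, X u⟫ + ⟪partialD X 0 u, partialD X 0 u⟫) +
      2 * rawSecond X 0 1 u * (⟪partialD₂ X 0 1 u, X u⟫ + ⟪partialD X 0 u, partialD X 1 u⟫) -
      rawSecond X 0 0 u * (⟪partialD₂ X 1 1 u, X u⟫ + ⟪partialD X 1 u, partialD X 1 u⟫)) =
    driftCoord X 0 u * ⟪X u, partialD X 0 u⟫ + driftCoord X 1 u * ⟪X u, partialD X 1 u⟫ := by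
  have hrel := h.polynomial_relation hD (by rw [rawSecond, rawSecond, partialD₂_comm hX])
  have h00 := gramDet_mul_inner (X := X) (u := u) (partialD₂ X 0 0 u)
  have h01 := gramDet_mul_inner (X := X) (u := u) (partialD₂ X 0 1 u)
  have h11 := gramDet_mul_inner (X := X) (u := u) (partialD₂ X 1 1 u)
  have hXX := gramDet_mul_inner (X := X) (u := u) (X u)
  change _ = _ + rawSecond X 0 0 u * _ at h00
  change _ = _ + rawSecond X 0 1 u * _ at h01
  change _ = _ + rawSecond X 1 1 u * _ at h11
  change gramDet X u * distSq X u = _ + rawSupport X u * _ at hXX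
  simp only [driftCoord, rawDisc]
  linear_combination (-rawSupport X u * rawSecond X 1 1 u) * h00 +
    (2 * rawSupport X u * rawSecond X 0 1 u) * h01 -
    (rawSupport X u * rawSecond X 0 0 u) * h11 - hrel +
    (rawSecond X 0 0 u * rawSecond X 1 1 u - rawSecond X 0 1 u ^ 2) * hXX

end Patch

/-! ### Local constancy of the squared distance at a maximum -/

section Patch

variable {X : Plane → Space} {u : Plane}

/-- A lower bound of a `2 × 2` Gram matrix by the quotient of its determinant and trace. -/
theorem gram_lower_bound {p q δ : ℝ} (hp : 0 < p) (hδ : 0 < δ) (x y : ℝ) :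
    p ^ 2 * δ / (p ^ 2 + q ^ 2 + δ) * (x ^ 2 + y ^ 2) ≤ (p * x + q * y) ^ 2 + δ * y ^ 2 := by
  have hT : 0 < p ^ 2 + q ^ 2 + δ := by positivity
  rw [div_mul_eq_mul_div, div_le_iff₀ hT]
  -- by the Cayley-Hamilton theorem the difference is the squared norm of the image of `(x, y)`
  have : ((p * x + q * y) ^ 2 + δ * y ^ 2) * (p ^ 2 + q ^ 2 + δ) - p ^ 2 * δ * (x ^ 2 + y ^ 2) =
      (p * (p * x + q * y)) ^ 2 + (q * (p * x + q * y) + δ * y) ^ 2 := by ring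
  nlinarith [sq_nonneg (p * (p * x + q * y)), sq_nonneg (q * (p * x + q * y) + δ * y)]

theorem continuousAt_tangentialCoord (hX : ContDiffAt ℝ 2 X u) (i : Fin 2) {t : Plane → Space}
    (ht : ContinuousAt t u) : ContinuousAt (fun y => tangentialCoord X i (t y) y) u := by
  have h := fun j => continuousAt_partialD hX j
  exact (((h (1 - i)).inner (h (1 - i))).mul (ht.inner (h i))).sub
    (((h 0).inner (h 1)).mul (ht.inner (h (1 - i))))

theorem continuousAt_rawDisc (hX : ContDiffAt ℝ 2 X u) : ContinuousAt (rawDisc X) u := by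
  have h := continuousAt_rawSecond hX
  exact ((h 0 0).mul (h 1 1)).sub ((h 0 1).pow 2)

theorem continuousAt_driftCoord (hX : ContDiffAt ℝ 2 X u) (i : Fin 2) :
    ContinuousAt (driftCoord X i) u := by
  have h := continuousAt_rawSecond hX
  have ht := fun j k => continuousAt_tangentialCoord hX i (continuousAt_partialD₂ hX j k)
  exact ((continuousAt_rawSupport hX).mul ((((h 1 1).neg.mul (ht 0 0)).add
    ((continuousAt_const.mul (h 0 1)).mul (ht 0 1))).sub ((h 0 0).mul (ht 1 1)))).add
    ((continuousAt_rawDisc hX).mul (continuousAt_tangentialCoord hX i hX.continuousAt))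

theorem fderiv_fderiv_distSq_combo (hX : ContDiffAt ℝ 2 X u) (x y : ℝ) :
    fderiv ℝ (fderiv ℝ (distSq X)) u
      (x • EuclideanSpace.single 0 1 + y • EuclideanSpace.single 1 1)
      (x • EuclideanSpace.single 0 1 + y • EuclideanSpace.single 1 1) =
    2 * (x ^ 2 * (⟪partialD₂ X 0 0 u, X u⟫ + ⟪partialD X 0 u, partialD X 0 u⟫) +
      2 * (x * y) * (⟪partialD₂ X 0 1 u, X u⟫ + ⟪partialD X 0 u, partialD X 1 u⟫) +
      y ^ 2 * (⟪partialD₂ X 1 1 u, X u⟫ + ⟪partialD X 1 u, partialD X 1 u⟫)) := by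
  have hc := partialD₂_comm hX 1 0
  have e := partialD₂_eq hX
  have e' : ∀ i, partialD X i u = fderiv ℝ X u (EuclideanSpace.single i 1) := fun i => rfl
  simp only [map_add, map_smul, _root_.add_apply, _root_.smul_apply,
    fderiv_fderiv_distSq_apply hX, ← e, ← e', hc, real_inner_comm (partialD X 0 u) (partialD X 1 u),
    smul_eq_mul]
  ring

/-- The strong maximum principle in the plane, with the second-order part of the operator written
as `(p ∂₁ + q ∂₂)² + δ ∂₂²`. -/
theorem eventually_eq_of_isLocalMax_of_plane_elliptic {w p q δ b c : Plane → ℝ}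
    (hw : ContDiffAt ℝ 2 w u) (hpc : ContinuousAt p u) (hqc : ContinuousAt q u)
    (hδc : ContinuousAt δ u) (hbc : ContinuousAt b u) (hcc : ContinuousAt c u)
    (hp0 : 0 < p u) (hδ0 : 0 < δ u)
    (hL : ∀ᶠ y in 𝓝 u, 0 ≤ fderiv ℝ (fderiv ℝ w) y
        (p y • EuclideanSpace.single 0 1 + q y • EuclideanSpace.single 1 1)
        (p y • EuclideanSpace.single 0 1 + q y • EuclideanSpace.single 1 1) +
      δ y * fderiv ℝ (fderiv ℝ w) y (EuclideanSpace.single 1 1) (EuclideanSpace.single 1 1) +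
      fderiv ℝ w y (b y • EuclideanSpace.single 0 1 + c y • EuclideanSpace.single 1 1))
    (hmax : IsLocalMax w u) : ∀ᶠ y in 𝓝 u, w y = w u := by
  have hlamc : ContinuousAt (fun y => p y ^ 2 * δ y / (p y ^ 2 + q y ^ 2 + δ y)) u :=
    ((hpc.pow 2).mul hδc).div (((hpc.pow 2).add (hqc.pow 2)).add hδc) (by positivity)
  have hlam0 : 0 < p u ^ 2 * δ u / (p u ^ 2 + q u ^ 2 + δ u) := by positivity
  obtain ⟨lam, hlam, hev1⟩ : ∃ lam > 0, ∀ᶠ y in 𝓝 u,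
      lam < p y ^ 2 * δ y / (p y ^ 2 + q y ^ 2 + δ y) :=
    ⟨_, half_pos hlam0, hlamc.eventually (lt_mem_nhds (half_lt_self hlam0))⟩
  let ξ₀ : Plane → Plane := fun y =>
    p y • EuclideanSpace.single 0 1 + q y • EuclideanSpace.single 1 1
  let ξ₁ : Plane → Plane := fun y => √(δ y) • EuclideanSpace.single 1 1
  let β : Plane → Plane := fun y =>
    b y • EuclideanSpace.single 0 1 + c y • EuclideanSpace.single 1 1
  have hξ₀ : ContinuousAt ξ₀ u := (hpc.smul continuousAt_const).add (hqc.smul continuousAt_const)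
  have hξ₁ : ContinuousAt ξ₁ u := hδc.sqrt.smul continuousAt_const
  have hβ : ContinuousAt β u := (hbc.smul continuousAt_const).add (hcc.smul continuousAt_const)
  have hξc : ContinuousAt (fun y => ‖ξ₀ y‖ ^ 2 + ‖ξ₁ y‖ ^ 2) u :=
    (hξ₀.norm.pow 2).add (hξ₁.norm.pow 2)
  obtain ⟨B₁, hB₁⟩ : ∃ B, ∀ᶠ y in 𝓝 u, ‖ξ₀ y‖ ^ 2 + ‖ξ₁ y‖ ^ 2 < B :=
    ⟨_, hξc.eventually (gt_mem_nhds (lt_add_one _))⟩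
  obtain ⟨B₂, hB₂⟩ : ∃ B, ∀ᶠ y in 𝓝 u, ‖β y‖ < B :=
    ⟨_, hβ.norm.eventually (gt_mem_nhds (lt_add_one _))⟩
  have hδev := hδc.eventually (lt_mem_nhds hδ0)
  refine eventually_eq_of_isLocalMax_of_elliptic hw (ξ := ![ξ₀, ξ₁]) (β := β)
    (lam := lam) (B := max B₁ B₂) hlam ?_ ?_ ?_ ?_ hmax
  · filter_upwards [hpc.eventually (lt_mem_nhds hp0), hδev, hev1] with y h1 h2 h3 η
    have h4 := gram_lower_bound (q := q y) h1 h2 (η 0) (η 1)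
    have h6 : ⟪ξ₀ y, η⟫ = p y * η 0 + q y * η 1 := by
      simp [ξ₀, inner_add_left, real_inner_smul_left, EuclideanSpace.inner_single_left]
    have h7 : ⟪ξ₁ y, η⟫ = √(δ y) * η 1 := by
      simp [ξ₁, real_inner_smul_left, EuclideanSpace.inner_single_left]
    rw [Fin.sum_univ_two]
    change _ ≤ ⟪ξ₀ y, η⟫ ^ 2 + ⟪ξ₁ y, η⟫ ^ 2
    rw [h6, h7, mul_pow,
      Real.sq_sqrt h2.le, EuclideanSpace.real_norm_sq_eq, Fin.sum_univ_two]
    exact le_trans (by gcongr) h4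
  · filter_upwards [hB₁] with y hy
    rw [Fin.sum_univ_two]
    exact hy.le.trans (le_max_left _ _)
  · filter_upwards [hB₂] with y hy using hy.le.trans (le_max_right _ _)
  · filter_upwards [hL, hδev] with y hy h2
    refine hy.trans_eq ?_
    rw [Fin.sum_univ_two]
    change _ = _ + fderiv ℝ (fderiv ℝ w) y (√(δ y) • EuclideanSpace.single 1 1)
      (√(δ y) • EuclideanSpace.single 1 1) + _
    simp only [map_smul, _root_.smul_apply, smul_eq_mul]
    rw [← mul_assoc, Real.mul_self_sqrt h2.le]
    rfl

/-- Near a local maximum of `Λ` an SS-patch lies on a sphere about the origin. -/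
theorem eventually_distSq_eq_of_isLocalMax (hX : ContDiffAt ℝ 2 X u)
    (himm : Function.Injective (fderiv ℝ X u)) (hss : ∀ᶠ y in 𝓝 u, IsSSAt X y)
    (hmax : IsLocalMax (distSq X) u) : ∀ᶠ y in 𝓝 u, distSq X y = distSq X u := by
  obtain ⟨hp0, hδ0⟩ := second_form_definite_of_isLocalMax hX himm hmax
  have hD0 : 0 < gramDet X u := gram_pos himm
  have hs := continuousAt_rawSupport hX
  have hDc := continuousAt_gramDet hX
  have hpc : ContinuousAt (fun y => -(rawSupport X y * rawSecond X 1 1 y)) u :=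
    (hs.mul (continuousAt_rawSecond hX 1 1)).neg
  have hbc : ∀ i, ContinuousAt (fun y => rawSupport X y * rawSecond X 1 1 y *
      driftCoord X i y / gramDet X y) u := fun i =>
    ((hs.mul (continuousAt_rawSecond hX 1 1)).mul (continuousAt_driftCoord hX i)).div hDc hD0.ne'
  refine eventually_eq_of_isLocalMax_of_plane_elliptic (contDiffAt_distSq hX) hpc
    (hs.mul (continuousAt_rawSecond hX 0 1)) ((hs.pow 2).mul (continuousAt_rawDisc hX))
    (hbc 0) (hbc 1) hp0 hδ0 ?_ hmax
  filter_upwards [hX.eventually (by simp), hss, hDc.eventually (lt_mem_nhds hD0)]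
    with y hXy hssy hDy
  refine le_of_eq ?_
  have heq := hssy.elliptic_equation hXy hDy
  have h01 := fderiv_fderiv_distSq_combo hXy 0 1
  rw [zero_smul, one_smul, zero_add] at h01
  rw [fderiv_fderiv_distSq_combo hXy, h01]
  simp only [map_add, map_smul, fderiv_distSq_apply (hXy.differentiableAt (by norm_num)),
    inner_add_right, real_inner_smul_right, Pi.mul_apply, Pi.pow_apply]
  change _ = _ + 2 * (_ * ⟪X y, partialD X 0 y⟫ + _ * ⟪X y, partialD X 1 y⟫)
  simp only [rawDisc]
  generalize driftCoord X 0 y = d₀ at *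
  generalize driftCoord X 1 y = d₁ at *
  generalize gramDet X y = D at *
  field_simp
  linear_combination 2 * (rawSupport X y * rawSecond X 1 1 y) * heq

end Patch

/-! ### Coverings of the sphere and patches of a sphere -/

section Covering

/-- A section `s` of a connected covering `p` is a two-sided inverse, as `s ∘ p` and the identity
are lifts of `p` that agree at a point. -/
theorem injective_of_isCoveringMap_of_section {E Y : Type*} [TopologicalSpace E]
    [TopologicalSpace Y] [PreconnectedSpace E] {p : E → Y} (hp : IsCoveringMap p) {s : Y → E} (hs : Continuous s)
    (hps : ∀ y, p (s y) = y) : Function.Injective p := by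
  intro e₁ e₂ h
  have hid : s ∘ p = id := hp.eq_of_comp_eq (hs.comp hp.continuous) continuous_id
    (funext fun e => hps (p e)) (s (p e₁)) (by simp [hps])
  have h1 := congrFun hid e₁
  have h2 := congrFun hid e₂
  simp only [Function.comp_apply, id] at h1 h2
  rw [← h1, ← h2, h]

/-- A weak form of the Seifert-van Kampen theorem: a space covered by two simply connected open
pieces with connected intersection has no nontrivial connected covering. Lifts of the two pieces
that agree at one common point glue to a section. -/
theorem injective_of_isCoveringMap_of_simplyConnected_cover {E Y A B : Type*} [TopologicalSpace E]
    [TopologicalSpace Y] [TopologicalSpace A] [TopologicalSpace B] [PreconnectedSpace E]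
    [SimplyConnectedSpace A] [LocallyPathConnectedSpace A] [SimplyConnectedSpace B]
    [LocallyPathConnectedSpace B] {p : E → Y} (hp : IsCoveringMap p)
    (hsurj : Function.Surjective p) {i : A → Y} {j : B → Y} (hi : IsOpenEmbedding i)
    (hj : IsOpenEmbedding j) (hcover : ∀ y, y ∈ Set.range i ∨ y ∈ Set.range j)
    (hconn : IsConnected (j ⁻¹' Set.range i)) : Function.Injective p := by
  obtain ⟨b₀, a₀, hab⟩ := hconn.nonempty
  obtain ⟨e₀, he₀⟩ := hsurj (i a₀)
  obtain ⟨F, ⟨hF0, hF⟩, -⟩ :=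
    hp.existsUnique_continuousMap_lifts ⟨i, hi.continuous⟩ a₀ e₀ he₀
  obtain ⟨G, ⟨hG0, hG⟩, -⟩ :=
    hp.existsUnique_continuousMap_lifts ⟨j, hj.continuous⟩ b₀ e₀ (he₀.trans hab)
  have hF' : ∀ a, p (F a) = i a := congrFun hF
  have hG' : ∀ b, p (G b) = j b := congrFun hG
  have : Nonempty A := ⟨a₀⟩
  let k : Y → A := (hi.toOpenPartialHomeomorph i).symm
  have hk : ∀ a, k (i a) = a := fun a =>
    (hi.toOpenPartialHomeomorph i).left_inv (Set.mem_univ a)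
  have hkc : ContinuousOn k (Set.range i) := by
    have := (hi.toOpenPartialHomeomorph i).continuousOn_symm
    simpa using this
  have hagree : (j ⁻¹' Set.range i).EqOn (F ∘ k ∘ j) G := by
    refine hp.eqOn_of_comp_eqOn hconn.isPreconnected
      (F.continuous.comp_continuousOn (hkc.comp hj.continuous.continuousOn fun b hb => hb))
      G.continuous.continuousOn ?_ (a := b₀) ⟨a₀, hab⟩ ?_
    · rintro b ⟨a, hb⟩
      simp only [Function.comp_apply, ← hb, hk, hF', hG']
    · simp only [Function.comp_apply, ← hab, hk, hF0, hG0]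
  have hex : ∀ y, ∃ e, (∀ a, i a = y → F a = e) ∧ ∀ b, j b = y → G b = e := by
    intro y
    rcases hcover y with ⟨a, rfl⟩ | ⟨b, rfl⟩
    · refine ⟨F a, fun a' h => by rw [hi.injective h], fun b h => ?_⟩
      have := hagree (x := b) ⟨a, h.symm⟩
      simp only [Function.comp_apply, h, hk] at this
      exact this.symm
    · refine ⟨G b, fun a h => ?_, fun b' h => by rw [hj.injective h]⟩
      have := hagree (x := b) ⟨a, h⟩
      simpa only [Function.comp_apply, ← h, hk] using this
  choose s hsi hsj using hex
  have hsi' : s ∘ i = F := funext fun a => (hsi _ a rfl).symm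
  have hsj' : s ∘ j = G := funext fun b => (hsj _ b rfl).symm
  refine injective_of_isCoveringMap_of_section hp (s := s) ?_ fun y => ?_
  · rw [continuous_iff_continuousAt]
    intro y
    rcases hcover y with ⟨a, rfl⟩ | ⟨b, rfl⟩
    · rw [← hi.continuousAt_iff, hsi']; exact F.continuous.continuousAt
    · rw [← hj.continuousAt_iff, hsj']; exact G.continuous.continuousAt
  · rcases hcover y with ⟨a, rfl⟩ | ⟨b, rfl⟩
    · rw [← hsi _ a rfl, hF']
    · rw [← hsj _ b rfl, hG']

/-- Spheres of dimension at least two have no nontrivial connected coverings: the two stereographic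
parametrizations, from opposite poles, are by planes and overlap in a punctured plane. -/
theorem injective_of_isCoveringMap_sphere {E V : Type*} [TopologicalSpace E] [PreconnectedSpace E]
    [NormedAddCommGroup V] [InnerProductSpace ℝ V] {n : ℕ}
    [hfin : Fact (Module.finrank ℝ V = n + 1)] (hn : 2 ≤ n)
    {p : E → Metric.sphere (0 : V) 1} (hp : IsCoveringMap p)
    (hsurj : Function.Surjective p) : Function.Injective p := by
  rcases isEmpty_or_nonempty E with hE | ⟨⟨e⟩⟩
  · exact Function.injective_of_subsingleton p
  have hv : ‖(p e : V)‖ = 1 := norm_eq_of_mem_sphere (p e)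
  have hv' : ‖((-p e : Metric.sphere (0 : V) 1) : V)‖ = 1 := norm_eq_of_mem_sphere (-p e)
  generalize p e = v at hv hv'
  refine injective_of_isCoveringMap_of_simplyConnected_cover hp hsurj
    (isOpenEmbedding_stereographic_symm hv) (isOpenEmbedding_stereographic_symm hv') ?_ ?_
  · intro y
    rw [range_stereographic_symm, range_stereographic_symm]
    by_contra! h
    simp only [Set.mem_compl_iff, Set.mem_singleton_iff, not_not] at h
    exact ne_neg_of_mem_unit_sphere ℝ v (h.1.symm.trans h.2)
  · have hne : ((-v : Metric.sphere (0 : V) 1) : V) ≠ 0 := norm_ne_zero_iff.1 (by simp)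
    have hpre : (stereographic hv').symm ⁻¹' Set.range (stereographic hv).symm = {0}ᶜ := by
      ext w
      rw [Set.mem_preimage, range_stereographic_symm, Set.mem_compl_iff, Set.mem_compl_iff,
        Set.mem_singleton_iff, Set.mem_singleton_iff, not_iff_not]
      have h0 : stereographic hv' v = 0 := stereographic_neg_apply v
      constructor
      · intro h
        have := (stereographic hv').right_inv (x := w) (Set.mem_univ w)
        rw [h] at this
        exact this.symm.trans h0
      · rintro rfl
        rw [← h0]
        exact (stereographic hv').left_inv fun h => ne_neg_of_mem_unit_sphere ℝ v h
    rw [hpre]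
    refine isConnected_compl_singleton_of_one_lt_rank ?_ 0
    have : FiniteDimensional ℝ V := .of_fact_finrank_eq_succ n
    rw [← Module.finrank_eq_rank, Submodule.finrank_orthogonal_span_singleton (n := n) hne]
    exact_mod_cast hn

end Covering

section LocalHomeomorph

variable {X : Plane → Space} {u : Plane}

/-- The cone over a patch of a sphere about the origin has an invertible derivative, so the inverse
function theorem applies to it. -/
theorem exists_hasStrictFDerivAt_cone (hX : ContDiffAt ℝ 1 X u)
    (himm : Function.Injective (fderiv ℝ X u)) (h0 : X u ≠ 0)
    (hperp : ∀ η, ⟪X u, fderiv ℝ X u η⟫ = 0) :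
    ∃ e : (Plane × ℝ) ≃L[ℝ] Space,
      HasStrictFDerivAt (fun z : Plane × ℝ => z.2 • X z.1) (e : Plane × ℝ →L[ℝ] Space) (u, 1) := by
  have hX' : HasStrictFDerivAt X (fderiv ℝ X u) u := hX.hasStrictFDerivAt (by norm_num)
  have h1 : HasStrictFDerivAt (fun z : Plane × ℝ => X z.1)
      ((fderiv ℝ X u).comp (ContinuousLinearMap.fst ℝ Plane ℝ)) (u, 1) :=
    HasStrictFDerivAt.comp (g := X) (f := Prod.fst) (u, (1 : ℝ)) hX' hasStrictFDerivAt_fst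
  have h2 : HasStrictFDerivAt (fun z : Plane × ℝ => z.2) (ContinuousLinearMap.snd ℝ Plane ℝ)
      (u, 1) := hasStrictFDerivAt_snd
  have h3 := h2.smul h1
  set L : Plane × ℝ →L[ℝ] Space := (1 : ℝ) • (fderiv ℝ X u).comp
    (ContinuousLinearMap.fst ℝ Plane ℝ) + (ContinuousLinearMap.snd ℝ Plane ℝ).smulRight (X u)
    with hL
  have hLa : ∀ z, L z = fderiv ℝ X u z.1 + z.2 • X u := fun z => by simp [hL]
  have hinj : Function.Injective L := by
    rw [injective_iff_map_eq_zero]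
    rintro ⟨ξ, τ⟩ h
    rw [hLa] at h
    have h4 : τ = 0 := by
      have := congrArg (fun y => ⟪X u, y⟫) h
      simpa [inner_add_right, real_inner_smul_right, hperp, h0] using this
    rw [h4, zero_smul, add_zero] at h
    have h5 : ξ = 0 := himm (by rw [h, map_zero])
    rw [h4, h5]; rfl
  have hfr : Module.finrank ℝ (Plane × ℝ) = Module.finrank ℝ Space := by simp
  exact ⟨(LinearEquiv.ofInjectiveOfFinrankEq (L : Plane × ℝ →ₗ[ℝ] Space) hinj
    hfr).toContinuousLinearEquiv, h3⟩

theorem exists_nhds_injOn_of_perp (hX : ContDiffAt ℝ 1 X u)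
    (himm : Function.Injective (fderiv ℝ X u)) (h0 : X u ≠ 0)
    (hperp : ∀ η, ⟪X u, fderiv ℝ X u η⟫ = 0) : ∃ U ∈ 𝓝 u, Set.InjOn X U := by
  obtain ⟨e, he⟩ := exists_hasStrictFDerivAt_cone hX himm h0 hperp
  set Φ := he.toOpenPartialHomeomorph _ with hΦ
  have hs : Φ.source ∈ 𝓝 (u, (1 : ℝ)) :=
    Φ.open_source.mem_nhds he.mem_toOpenPartialHomeomorph_source
  refine ⟨(fun y => (y, (1 : ℝ))) ⁻¹' Φ.source,
    (Continuous.prodMk_left (1 : ℝ)).continuousAt.preimage_mem_nhds hs, fun x hx y hy h => ?_⟩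
  have := Φ.injOn hx hy (show (1 : ℝ) • X x = (1 : ℝ) • X y by rw [h])
  exact (Prod.ext_iff.1 this).1

/-- An immersed patch of a sphere about the origin covers a neighbourhood in that sphere: the cone
over it covers a neighbourhood in space, and its points of the right norm have factor `t = 1`. -/
theorem eventually_mem_image_of_distSq_eq (hX : ContDiffAt ℝ 1 X u)
    (himm : Function.Injective (fderiv ℝ X u)) (h0 : X u ≠ 0)
    (hconst : ∀ᶠ y in 𝓝 u, distSq X y = distSq X u) {V : Set Plane} (hV : V ∈ 𝓝 u)
    (hperp : ∀ η, ⟪X u, fderiv ℝ X u η⟫ = 0) :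
    ∀ᶠ y in 𝓝 (X u), ⟪y, y⟫ = distSq X u → y ∈ X '' V := by
  obtain ⟨e, he⟩ := exists_hasStrictFDerivAt_cone hX himm h0 hperp
  have hmap := he.map_nhds_eq_of_equiv
  rw [one_smul] at hmap
  have hset : (V ∩ {y | distSq X y = distSq X u}) ×ˢ Set.Ioi (0 : ℝ) ∈ 𝓝 (u, (1 : ℝ)) :=
    prod_mem_nhds (inter_mem hV hconst) (Ioi_mem_nhds one_pos)
  have := hmap ▸ image_mem_map (m := fun z : Plane × ℝ => z.2 • X z.1) hset
  filter_upwards [this]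
  rintro _ ⟨⟨x, t⟩, ⟨⟨hxV, hx⟩, ht⟩, rfl⟩ hy
  have hpos : 0 < distSq X u := real_inner_self_pos.2 h0
  have h1 : t ^ 2 * distSq X u = distSq X u := by
    refine Eq.trans ?_ hy
    rw [← show distSq X x = distSq X u from hx]
    simp only [real_inner_smul_left, real_inner_smul_right, distSq]
    ring
  have h2 : t = 1 := by
    have h3 : t ^ 2 = 1 := by
      have := mul_right_cancel₀ hpos.ne' (h1.trans (one_mul _).symm)
      exact this
    have ht' : (0 : ℝ) < t := ht
    nlinarith
  exact ⟨x, hxV, by simp [h2]⟩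

end LocalHomeomorph

/-! ### Compact SS-surfaces -/

section Global

variable {M : Type*} [TopologicalSpace M] [ChartedSpace Plane M] {f : M → Space}

theorem IsSSSurface.contDiffAt_chart [IsManifold (𝓡 2) ∞ M] (hf : IsSSSurface f) (p : M) :
    ContDiffAt ℝ 2 (f ∘ (chartAt Plane p).symm) (chartAt Plane p p) := by
  have h1 : ContMDiffOn (𝓡 2) 𝓘(ℝ, Space) ∞ (f ∘ (chartAt Plane p).symm)
      (chartAt Plane p).target :=
    hf.smooth.comp_contMDiffOn contMDiffOn_chart_symm
  have h2 := contMDiffOn_iff_contDiffOn.1 h1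
  exact (h2.contDiffAt ((chartAt Plane p).open_target.mem_nhds (mem_chart_target Plane p))).of_le
    ENat.LEInfty.out

theorem IsSSSurface.injective_fderiv_chart [IsManifold (𝓡 2) ∞ M] (hf : IsSSSurface f) (p : M) :
    Function.Injective (fderiv ℝ (f ∘ (chartAt Plane p).symm) (chartAt Plane p p)) := by
  have : IsManifold (𝓡 2) 1 M := IsManifold.of_le (n := ∞) ENat.LEInfty.out
  have hφ := mdifferentiable_chart (I := 𝓡 2) p
  have ht := mem_chart_target Plane p
  have hl : (chartAt Plane p).symm (chartAt Plane p p) = p :=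
    (chartAt Plane p).left_inv (mem_chart_source Plane p)
  have h1 : MDifferentiableAt (𝓡 2) 𝓘(ℝ, Space) f
      ((chartAt Plane p).symm (chartAt Plane p p)) :=
    (hf.smooth _).mdifferentiableAt (by simp)
  have h2 := mfderiv_comp (chartAt Plane p p) h1 (hφ.mdifferentiableAt_symm ht)
  rw [← mfderiv_eq_fderiv, h2]
  exact (hf.immersion _).comp (hφ.symm.mfderiv_injective ht)

theorem IsSSSurface.eventually_isSSAt_chart (hf : IsSSSurface f) (p : M) :
    ∀ᶠ u in 𝓝 (chartAt Plane p p), IsSSAt (f ∘ (chartAt Plane p).symm) u := by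
  filter_upwards [(chartAt Plane p).open_target.mem_nhds (mem_chart_target Plane p)] with u hu
    using hf.ss _ (chart_mem_atlas _ _) u hu

theorem distSq_chart (p : M) : distSq (f ∘ (chartAt Plane p).symm) (chartAt Plane p p) =
    ⟪f p, f p⟫ := by
  simp [distSq, (chartAt Plane p).left_inv (mem_chart_source Plane p)]

theorem tendsto_chart_symm (p : M) :
    Tendsto (chartAt Plane p).symm (𝓝 (chartAt Plane p p)) (𝓝 p) := by
  have := (chartAt Plane p).continuousAt_symm (mem_chart_target Plane p)
  rwa [ContinuousAt, (chartAt Plane p).left_inv (mem_chart_source Plane p)] at this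

theorem IsSSSurface.eventually_inner_eq_of_isMax [IsManifold (𝓡 2) ∞ M] (hf : IsSSSurface f)
    {p : M} (hp : ∀ q, ⟪f q, f q⟫ ≤ ⟪f p, f p⟫) : ∀ᶠ q in 𝓝 p, ⟪f q, f q⟫ = ⟪f p, f p⟫ := by
  have hloc := eventually_distSq_eq_of_isLocalMax (hf.contDiffAt_chart p)
    (hf.injective_fderiv_chart p) (hf.eventually_isSSAt_chart p)
    (Eventually.of_forall fun u => (hp _).trans_eq (distSq_chart p).symm)
  rw [distSq_chart] at hloc
  have hφ : ContinuousAt (chartAt Plane p) p :=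
    (chartAt Plane p).continuousAt (mem_chart_source Plane p)
  filter_upwards [hφ.eventually hloc,
    (chartAt Plane p).open_source.mem_nhds (mem_chart_source Plane p)] with q hq hqs
  simpa [distSq, (chartAt Plane p).left_inv hqs] using hq

/-- The set where `Λ` attains its maximum is open and closed. -/
theorem IsSSSurface.exists_inner_eq_const [CompactSpace M] [ConnectedSpace M]
    [IsManifold (𝓡 2) ∞ M] (hf : IsSSSurface f) : ∃ c, ∀ p, ⟪f p, f p⟫ = c := by
  have hc : Continuous fun p => ⟪f p, f p⟫ := hf.smooth.continuous.inner hf.smooth.continuous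
  obtain ⟨p₀, -, hp₀⟩ := isCompact_univ.exists_isMaxOn Set.univ_nonempty hc.continuousOn
  have hclopen : IsClopen {p | ⟪f p, f p⟫ = ⟪f p₀, f p₀⟫} := by
    refine ⟨isClosed_eq hc continuous_const, isOpen_iff_mem_nhds.2 fun p hp => ?_⟩
    have hp' : ⟪f p, f p⟫ = ⟪f p₀, f p₀⟫ := hp
    filter_upwards [hf.eventually_inner_eq_of_isMax (p := p) fun q =>
      le_of_le_of_eq (hp₀ (Set.mem_univ q)) hp'.symm] with q hq using hq.trans hp'
  have huniv := hclopen.eq_univ ⟨p₀, rfl⟩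
  exact ⟨⟪f p₀, f p₀⟫, fun p => (huniv ▸ Set.mem_univ p : p ∈ {p | ⟪f p, f p⟫ = _})⟩

/-- An SS-surface on a sphere about the origin maps to the unit sphere by a local homeomorphism,
namely the radial projection `F` of `f`. -/
theorem IsSSSurface.isLocalHomeomorph_sphere [IsManifold (𝓡 2) ∞ M] (hf : IsSSSurface f)
    {r : ℝ} (hr : 0 < r) (hsph : ∀ p, f p ∈ Metric.sphere (0 : Space) r)
    {F : M → Metric.sphere (0 : Space) 1} (hF : ∀ p, r • (F p : Space) = f p) :
    IsLocalHomeomorph F := by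
  have hnorm : ∀ p, ‖f p‖ = r := fun p => by simpa using hsph p
  have hFc : Continuous F := by
    have : ∀ p, (F p : Space) = r⁻¹ • f p := fun p => by
      rw [← hF, smul_smul, inv_mul_cancel₀ hr.ne', one_smul]
    refine Continuous.subtype_mk (f := fun p => (F p : Space)) ?_ _
    simp only [this]
    exact hf.smooth.continuous.const_smul r⁻¹
  have hFf : ∀ p q, F p = F q ↔ f p = f q := fun p q => by
    rw [← hF, ← hF, smul_right_inj hr.ne', Subtype.ext_iff]
  have hdist : ∀ p u, distSq (f ∘ (chartAt Plane p).symm) u = r ^ 2 := fun p u => by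
    rw [distSq, real_inner_self_eq_norm_sq, Function.comp_apply, hnorm]
  have hperp : ∀ p η, ⟪(f ∘ (chartAt Plane p).symm) (chartAt Plane p p),
      fderiv ℝ (f ∘ (chartAt Plane p).symm) (chartAt Plane p p) η⟫ = 0 := fun p η => by
    have h := fderiv_distSq_apply ((hf.contDiffAt_chart p).differentiableAt (by norm_num)) η
    rw [show distSq (f ∘ (chartAt Plane p).symm) = fun _ => r ^ 2 from funext (hdist p)] at h
    simpa using h.symm
  have hne : ∀ p, (f ∘ (chartAt Plane p).symm) (chartAt Plane p p) ≠ 0 := fun p h => by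
    have := hnorm ((chartAt Plane p).symm (chartAt Plane p p))
    rw [show f ((chartAt Plane p).symm (chartAt Plane p p)) = 0 from h, norm_zero] at this
    exact hr.ne this
  have hC1 : ∀ p, ContDiffAt ℝ 1 (f ∘ (chartAt Plane p).symm) (chartAt Plane p p) := fun p =>
    (hf.contDiffAt_chart p).of_le (by norm_num)
  have hopen : IsOpenMap F := by
    rw [isOpenMap_iff_nhds_le]
    intro p s hs
    have hV : (chartAt Plane p).symm ⁻¹' (F ⁻¹' s) ∈ 𝓝 (chartAt Plane p p) :=
      tendsto_chart_symm p hs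
    have hev := eventually_mem_image_of_distSq_eq (hC1 p) (hf.injective_fderiv_chart p) (hne p)
      (Eventually.of_forall fun u => (hdist p u).trans (hdist p _).symm) hV (hperp p)
    have hpt : (f ∘ (chartAt Plane p).symm) (chartAt Plane p p) = r • (F p : Space) := by
      rw [hF, Function.comp_apply, (chartAt Plane p).left_inv (mem_chart_source Plane p)]
    rw [hpt, hdist] at hev
    have hcs : Continuous fun y : Metric.sphere (0 : Space) 1 => r • (y : Space) :=
      continuous_subtype_val.const_smul r
    filter_upwards [hcs.continuousAt.eventually hev] with y hy
    obtain ⟨u, hu, huy⟩ := hy (by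
      rw [real_inner_self_eq_norm_sq, norm_smul, norm_eq_of_mem_sphere, Real.norm_eq_abs,
        abs_of_pos hr, mul_one])
    have : F ((chartAt Plane p).symm u) = y := by
      rw [Function.comp_apply, ← hF] at huy
      exact Subtype.ext (smul_right_injective _ hr.ne' huy)
    exact this ▸ hu
  rw [isLocalHomeomorph_iff_isOpenEmbedding_restrict]
  intro p
  obtain ⟨U, hU, hinj⟩ := exists_nhds_injOn_of_perp (hC1 p) (hf.injective_fderiv_chart p)
    (hne p) (hperp p)
  have hφ : ContinuousAt (chartAt Plane p) p :=
    (chartAt Plane p).continuousAt (mem_chart_source Plane p)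
  obtain ⟨W, hWs, hWo, hpW⟩ := mem_nhds_iff.1 (inter_mem (hφ.preimage_mem_nhds hU)
    ((chartAt Plane p).open_source.mem_nhds (mem_chart_source Plane p)))
  refine ⟨W, hWo.mem_nhds hpW, IsOpenEmbedding.of_continuous_injective_isOpenMap
    (hFc.comp continuous_subtype_val) ?_ (hopen.comp hWo.isOpenMap_subtype_val)⟩
  rintro ⟨x, hx⟩ ⟨y, hy⟩ h
  have h' : f x = f y := (hFf x y).1 h
  refine Subtype.ext ((chartAt Plane p).injOn (hWs hx).2 (hWs hy).2
    (hinj (hWs hx).1 (hWs hy).1 ?_))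
  simpa [(chartAt Plane p).left_inv (hWs hx).2, (chartAt Plane p).left_inv (hWs hy).2] using h'

end Global

end SSSurf

/-- A compact, connected SS-surface in `ℝ³` is a round sphere (centred at the origin): the
immersion is one-to-one and its image is a sphere. -/
theorem mainTheorem4 {M : Type*} [TopologicalSpace M] [T2Space M] [CompactSpace M]
    [ConnectedSpace M] [ChartedSpace SSSurf.Plane M] [IsManifold (𝓡 2) ∞ M]
    (f : M → SSSurf.Space) (hf : SSSurf.IsSSSurface f) :
    ∃ r : ℝ, 0 < r ∧ Function.Injective f ∧
      Set.range f = Metric.sphere (0 : SSSurf.Space) r := by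
  open SSSurf in
  obtain ⟨c, hc⟩ := hf.exists_inner_eq_const
  obtain ⟨p₀⟩ : Nonempty M := inferInstance
  have hc0 : 0 < c := by
    rw [← hc p₀]
    refine real_inner_self_pos.2 fun h => ?_
    -- If the image were the origin, `f` would be constant and hence not an immersion.
    have hf0 : ∀ q, f q = 0 := fun q => inner_self_eq_zero (𝕜 := ℝ).1 (by
      rw [hc, ← hc p₀, h, inner_zero_left])
    have hinj := hf.injective_fderiv_chart p₀
    have hconst : f ∘ (chartAt Plane p₀).symm = fun _ => (0 : Space) := funext fun u => hf0 _
    rw [hconst] at hinj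
    have h1 := @hinj (EuclideanSpace.single 0 1) 0 (by simp)
    simpa using congrArg (fun x : Plane => x 0) h1
  have hr : 0 < √c := Real.sqrt_pos.2 hc0
  have hnorm : ∀ p, ‖f p‖ = √c := fun p => by rw [← hc p, norm_eq_sqrt_real_inner]
  have hsph : ∀ p, f p ∈ Metric.sphere (0 : Space) √c := fun p =>
    mem_sphere_zero_iff_norm.2 (hnorm p)
  let F : M → Metric.sphere (0 : Space) 1 := fun p => ⟨(√c)⁻¹ • f p, by
    rw [mem_sphere_zero_iff_norm, norm_smul, hnorm, norm_inv, Real.norm_eq_abs, abs_of_pos hr,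
      inv_mul_cancel₀ hr.ne']⟩
  have hF : ∀ p, √c • (F p : Space) = f p := fun p => by
    simp only [F]
    rw [smul_smul, mul_inv_cancel₀ hr.ne', one_smul]
  have hloc := hf.isLocalHomeomorph_sphere hr hsph hF
  have : Fact (Module.finrank ℝ Space = 2 + 1) := ⟨by simp⟩
  have : ConnectedSpace (Metric.sphere (0 : Space) 1) :=
    Subtype.connectedSpace
      (isConnected_sphere (Module.lt_rank_of_lt_finrank (by simp)) 0 zero_le_one)
  have hsurj : Function.Surjective F := by
    have hclopen : IsClopen (Set.range F) :=
      ⟨(isCompact_range hloc.continuous).isClosed, hloc.isOpenMap.isOpen_range⟩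
    exact Set.range_eq_univ.1 (hclopen.eq_univ (Set.range_nonempty F))
  have hinj : Function.Injective F := injective_of_isCoveringMap_sphere (n := 2) le_rfl
    (isLocalHomeomorph_iff_isCoveringMap.1 hloc) hsurj
  refine ⟨√c, hr, fun p q h => hinj (Subtype.ext ?_), Set.Subset.antisymm ?_ fun y hy => ?_⟩
  · simp only [F, h]
  · rintro _ ⟨p, rfl⟩; exact hsph p
  · obtain ⟨p, hp⟩ := hsurj ⟨(√c)⁻¹ • y, by
      rw [mem_sphere_zero_iff_norm] at hy ⊢
      rw [norm_smul, hy, norm_inv, Real.norm_eq_abs, abs_of_pos hr, inv_mul_cancel₀ hr.ne']⟩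
    refine ⟨p, ?_⟩
    rw [← hF p, hp, smul_smul, mul_inv_cancel₀ hr.ne', one_smul]
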